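/- Let $\Gamma$ be a finite simple graph without cycles (a forest; for instance a simply-laced Dynkin diagram) with vertex set $I$, and let $W$ be its Weyl group, i.e. the group with generators $s_i$ $(i\in I)$ and relations $s_i^2=1$, $(s_is_j)^3=1$ if $i,j$ are adjacent, $(s_is_j)^2=1$ if $i\ne j$ are not adjacent. Let $u,v\in W$ and let $\mathbf i=(i_1,\dots,i_N)$, $N=\ell(u)+\ell(v)$, be any shuffle of a reduced word of $u$, whose letters are given the sign $-1$, and a reduced word of $v$, whose letters are given the sign $+1$. Write $|i_k|\in I$ for the $k$-th letter and $\epsilon(i_k)$ for its sign. Put one further index $-i$ for each $i\in I$ before $1,\dots,N$, with $|i_{-i}|=i$. For an index $k$ let $k^+$ be the next index $l>k$ with $|i_l|=|i_k|$, and $k^+=N+1$ if there is none. The string over $i\in I$ consists of the indices $k$ with $|i_k|=i$. The BFZ quiver $Q^{u,v}=Q^{u,v}(\mathbf i)$, including the arrows between frozen vertices, has as vertices all these indices, and the following arrows. * Vertical arrows: if $l=k^+\le N$, an arrow $k\to l$ if $\epsilon(i_l)=+1$ and $l\to k$ if $\epsilon(i_l)=-1$. * Inclined arrows: let $k<l$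 with $l\ge 1$ and $|i_k|,|i_l|$ adjacent in $\Gamma$, and suppose that $l<k^+<l^+$ and $\epsilon(i_l)=\epsilon(i_{k^+})$, or that $l<l^+<k^+$ and $\epsilon(i_l)=-\epsilon(i_{l^+})$, or that $k^+=l^+=N+1$ (the last vertices of two adjacent strings). Then there is an arrow $k\to l$ if $\epsilon(i_l)=-1$ and $l\to k$ if $\epsilon(i_l)=+1$. * Bottom arrows: if $i,j\in I$ are adjacent and $m=(-i)^+<(-j)^+$, an arrow $-i\to -j$ if $\epsilon(i_m)=-1$ and $-j\to -i$ if $\epsilon(i_m)=+1$. Draw index $k$ at height $k$ on the string over $|i_k|$ (the indices $-i$ at height $0$), and for each edge of $\Gamma$ draw the strip between its two strings in the plane, with either string on the left. The faces are the bounded regions of these strips cut out by two successive inclined or bottom arrows; the boundary of a face is an oriented cycle. Let $$S=\sum(\text{clockwise oriented faces})-\sum(\text{anti-clockwise oriented faces})$$ be the superpotential, an element of the path algebra $\mathbb C Q$ of $Q=Q^{u,v}$. For an arrow $a$ let $\partial_a$ be the cyclic derivative, $\partial_a(a_1\cdots a_n)=\sum_{r:\,a_r=a}a_{r+1}\cdots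 a_na_1\cdots a_{r-1}$ on cycles, and let $J(S)$ be the two-sided ideal of $\mathbb CQ$ generated by $\partial_a S$ for all arrows $a$ of $Q$ (also those between frozen vertices). Then $S$ is rigid: for every cycle $c$ of positive length in $Q$ there is an element $j\in J(S)$, a linear combination of cycles, that is cyclically equivalent to $c$, i.e. $c-j$ lies in the closure of the span of all $\alpha_1\alpha_2\cdots\alpha_l-\alpha_2\cdots\alpha_l\alpha_1$, where $\alpha_1\cdots\alpha_l$ is a cycle of positive length. -/

import Mathlib

open Quiver

/-! ### Quivers with potential

Everything is done in the path algebra `ℂQ`; the space `e_x ℂQ e_y` of linear combinations of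
paths from `x` to `y` is `Path x y →₀ ℂ`.  Paths are composed from left to right. -/

namespace QP

universe v₁ u₁

variable {Q : Type u₁} [Quiver.{v₁} Q]

/-- Oriented cycles of `Q` with a base point (closed paths). -/
abbrev ClosedPath (Q : Type u₁) [Quiver.{v₁} Q] := Σ x : Q, Path x x

/-- Linear combinations of oriented cycles. -/
abbrev Potential (Q : Type u₁) [Quiver.{v₁} Q] := ClosedPath Q →₀ ℂ

open Classical in
/-- The list of all pairs `(p, q)` with `c = p a q`, one for each occurrence of the arrow `a`
in the path `c`. -/
noncomputable def splits {x y : Q} (a : x ⟶ y) {s : Q} :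
    ∀ {t : Q}, Path s t → List (Path s x × Path y t)
  | _, .nil => []
  | _, .cons (b := b) (c := t) p e =>
      (splits a p).map (fun z => (z.1, z.2.cons e)) ++
        if h : ∃ (hb : b = x) (ht : t = y), e.cast hb ht = a then
          [(p.cast rfl h.1, (Path.nil : Path t t).cast h.2.1 rfl)]
        else []

/-- The cyclic derivative of one cycle: `∂_a c = ∑ q p`, over all factorizations `c = p a q`. -/
noncomputable def cyclicDerivPath {x y : Q} (a : x ⟶ y) (c : ClosedPath Q) : Path y x →₀ ℂ :=
  ((splits a c.2).map fun z => Finsupp.single (z.2.comp z.1) (1 : ℂ)).sum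

/-- The cyclic derivative `∂_a`, extended linearly to potentials. -/
noncomputable def cyclicDeriv {x y : Q} (a : x ⟶ y) : Potential Q →ₗ[ℂ] (Path y x →₀ ℂ) :=
  Finsupp.linearCombination ℂ (cyclicDerivPath a)

/-- The component `e_s J(S) e_t` of the two-sided ideal `J(S)` of the path algebra generated by all
`∂_a S`: it is spanned by the products `p (∂_a S) q`, where `a` runs over all arrows, `p` over
the paths from `s` to the head of `a`, and `q` over the paths from the tail of `a` to `t`. -/
noncomputable def jacobianIdeal (S : Potential Q) (s t : Q) : Submodule ℂ (Path s t →₀ ℂ) :=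
  Submodule.span ℂ {z | ∃ (x y : Q) (a : x ⟶ y) (p : Path s y) (q : Path x t),
    z = (cyclicDeriv a S).mapDomain fun r => (p.comp r).comp q}

/-- The elements of the Jacobian ideal that are linear combinations of cycles. -/
noncomputable def jacobianCycles (S : Potential Q) : Submodule ℂ (Potential Q) :=
  ⨆ s : Q, (jacobianIdeal S s s).map (Finsupp.lmapDomain ℂ ℂ fun c => (⟨s, c⟩ : ClosedPath Q))

/-- The span of all `α₁ α₂ ⋯ α_l - α₂ ⋯ α_l α₁`, where `α₁ ⋯ α_l` is a cycle of positive length. -/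
noncomputable def rotationSpan (Q : Type u₁) [Quiver.{v₁} Q] : Submodule ℂ (Potential Q) :=
  Submodule.span ℂ {z | ∃ (x y : Q) (a : x ⟶ y) (p : Path y x),
    z = Finsupp.single ⟨x, a.toPath.comp p⟩ 1 - Finsupp.single ⟨y, p.cons a⟩ 1}

/-- Cyclic equivalence: `S - S'` lies in the closure of `rotationSpan Q` for the arrow-adic
topology, in which a basis of neighbourhoods of `0` is given by the combinations of paths of
length at least `n`. -/
def CyclicallyEquivalent (S S' : Potential Q) : Prop :=
  ∀ n : ℕ, ∃ z ∈ rotationSpan Q, ∀ c : ClosedPath Q, (S - S' - z) c ≠ 0 → n ≤ c.2.length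

/-- `(Q, S)` is rigid: every cycle (of positive length) is cyclically equivalent to an element of
the Jacobian ideal. -/
def IsRigid (S : Potential Q) : Prop :=
  ∀ c : ClosedPath Q, 0 < c.2.length →
    ∃ j ∈ jacobianCycles S, CyclicallyEquivalent (Finsupp.single c 1) j

/-- All arrows of the path satisfy `R`. -/
def AllArrows (R : Q → Q → Prop) {s : Q} : ∀ {t : Q}, Path s t → Prop
  | _, .nil => True
  | _, .cons (b := b) (c := t) p _ => AllArrows R p ∧ R b t

end QP

/-! ### Weyl groups of graphs and words for pairs of Weyl group elements -/

namespace BFZ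

universe u

open Classical in
/-- The Coxeter matrix of the symmetric Kac-Moody algebra with (simple) graph `Γ`:
`m_ij = 3` if `i` and `j` are joined by an edge and `m_ij = 2` otherwise (`i ≠ j`). -/
noncomputable def coxeterMatrix {I : Type u} (Γ : SimpleGraph I) : CoxeterMatrix I where
  M := Matrix.of fun i j => if i = j then 1 else if Γ.Adj i j then 3 else 2
  isSymm := by
    ext i j
    simp only [Matrix.transpose_apply, Matrix.of_apply, Γ.adj_comm j i, eq_comm (a := j)]
  diagonal i := by simp
  off_diagonal i j h := by
    simp only [Matrix.of_apply, if_neg h]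
    split_ifs <;> decide

/-- The Weyl group of `Γ`: generators `s_i`, relations `s_i² = 1`, `(s_i s_j)^{m_ij} = 1`. -/
abbrev WeylGroup {I : Type u} (Γ : SimpleGraph I) := (coxeterMatrix Γ).Group

/-- The subword of the letters of sign `ε`. -/
def subword {I : Type u} (w : List (I × ℤˣ)) (ε : ℤˣ) : List I :=
  (w.filter fun z => z.2 = ε).map Prod.fst

/-- `w` is a reduced word for `(u, v)`: a shuffle of a reduced word of `u`, whose letters carry the
sign `-1`, and a reduced word of `v`, whose letters carry the sign `+1`. -/
def IsReducedWordFor {I : Type u} (Γ : SimpleGraph I) (x y : WeylGroup Γ) (w : List (I × ℤˣ)) :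
    Prop :=
  (coxeterMatrix Γ).toCoxeterSystem.IsReduced (subword w (-1)) ∧
  (coxeterMatrix Γ).toCoxeterSystem.wordProd (subword w (-1)) = x ∧
  (coxeterMatrix Γ).toCoxeterSystem.IsReduced (subword w 1) ∧
  (coxeterMatrix Γ).toCoxeterSystem.wordProd (subword w 1) = y

/-! ### The quiver -/

/-- The vertices: `initial i` is the index `-i`, and `letter k` is the index of the `k`-th letter
(counted from `0`) of the word `w`. -/
inductive Vertex {I : Type u} (Γ : SimpleGraph I) (w : List (I × ℤˣ)) : Type u
  | initial (i : I) : Vertex Γ w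
  | letter (k : Fin w.length) : Vertex Γ w

namespace Vertex

variable {I : Type u} {Γ : SimpleGraph I} {w : List (I × ℤˣ)}

/-- The string (vertex of `Γ`) over which an index lies, i.e. `|i_k|`. -/
def str : Vertex Γ w → I
  | initial i => i
  | letter k => (w.get k).1

/-- The sign `ε(i_k)`; the indices `-i` have `i_{-i} = -i`, of sign `-1`. -/
def sgn : Vertex Γ w → ℤˣ
  | initial _ => -1
  | letter k => (w.get k).2

/-- The position (height): letters have positions `1, …, N`, in the order of the word; the
initial indices lie below all letters, at height `0`. -/
def pos : Vertex Γ w → ℕ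
  | initial _ => 0
  | letter k => k + 1

/-- `k⁺`: the smallest position `> k` of an index on the same string, and `N + 1` if there
is none. -/
noncomputable def next (k : Vertex Γ w) : ℕ :=
  sInf ({n | ∃ l : Vertex Γ w, l.str = k.str ∧ k.pos < l.pos ∧ l.pos = n} ∪ {w.length + 1})

/-- The upward arrow `k → k⁺ = l` along a string: `ε(i_l) = +1`. -/
def IsUp (k l : Vertex Γ w) : Prop := l.pos = k.next ∧ l.sgn = 1

/-- The downward arrow `l⁺ = k → l` along a string: `ε(i_k) = -1`. -/
def IsDown (k l : Vertex Γ w) : Prop := k.pos = l.next ∧ k.sgn = -1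

/-- The indices `k < l`, `l` a letter, are the ends of an inclined edge.  The first two cases are
the inclined edges of Berenstein, Fomin and Zelevinsky.  The third case is the added
edge between the (frozen) last vertices of two adjacent strings. -/
def Inclined (k l : Vertex Γ w) : Prop :=
  Γ.Adj k.str l.str ∧ k.pos < l.pos ∧
    ((l.pos < k.next ∧ k.next < l.next ∧ ∃ m : Vertex Γ w, m.pos = k.next ∧ m.sgn = l.sgn) ∨
     (l.next < k.next ∧ ∃ m : Vertex Γ w, m.pos = l.next ∧ m.sgn = -l.sgn) ∨
     (k.next = w.length + 1 ∧ l.next = w.length + 1))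

/-- The added edge between the (frozen) first vertices `k`, `l` of two adjacent strings not both of
which are without letters; `m` is the first letter on the two strings, and it lies on the
string of `k`. -/
def BottomWith (k l m : Vertex Γ w) : Prop :=
  Γ.Adj k.str l.str ∧ k.pos = 0 ∧ l.pos = 0 ∧ k.next < l.next ∧ m.pos = k.next

/-- There is an arrow from `k` to `l`: along a string; inclined, from the lower to the higher
end iff the sign of the higher end is `-1`; or at the bottom, with the direction for which the
lowest face is an oriented cycle. -/
def IsArrow (k l : Vertex Γ w) : Prop :=
  IsUp k l ∨ IsDown k l ∨
  (Inclined k l ∧ l.sgn = -1) ∨ (Inclined l k ∧ k.sgn = 1) ∨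
  (∃ m, BottomWith k l m ∧ m.sgn = -1) ∨ (∃ m, BottomWith l k m ∧ m.sgn = 1)

/-- The quiver `Q^{u,v}` of the word `w`, including the arrows between frozen vertices. -/
instance : Quiver (Vertex Γ w) where
  Hom k l := PLift (IsArrow k l)

instance (k l : Vertex Γ w) : Subsingleton (k ⟶ l) :=
  inferInstanceAs (Subsingleton (PLift (IsArrow k l)))

instance [Finite I] : Finite (Vertex Γ w) :=
  Finite.of_surjective (fun z : I ⊕ Fin w.length => z.elim initial letter) (by
    rintro (i | k)
    · exact ⟨.inl i, rfl⟩
    · exact ⟨.inr k, rfl⟩)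

end Vertex

open Vertex

/-! ### Faces and the superpotential -/

variable {I : Type u} {Γ : SimpleGraph I} {w : List (I × ℤˣ)}

/-- An oriented face: a bounded region of the strip between two adjacent strings, cut out by two
successive inclined arrows.  Its boundary runs up along the first string, from `a` to `a'`,
crosses to `b'` on the second string, runs down to `b`, and crosses back to `a`; one of
the two sides along the strings may have length `0`. -/
structure Face (Γ : SimpleGraph I) (w : List (I × ℤˣ)) where
  (a a' b b' : Vertex Γ w)
  adj : Γ.Adj a.str b.str
  up : Path a a'
  across : a' ⟶ b'
  down : Path b' b
  back : b ⟶ a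
  isUp : QP.AllArrows IsUp up
  isDown : QP.AllArrows IsDown down
  /-- No inclined arrow runs inside the region. -/
  empty : ∀ s t : Vertex Γ w, s.str = a.str → t.str = b.str →
    a.pos ≤ s.pos → s.pos ≤ a'.pos → b.pos ≤ t.pos → t.pos ≤ b'.pos →
    IsArrow s t ∨ IsArrow t s → (s = a ∧ t = b) ∨ (s = a' ∧ t = b')

/-- The boundary cycle of a face. -/
def Face.cycle (f : Face Γ w) : QP.ClosedPath (Vertex Γ w) :=
  ⟨f.a, ((f.up.cons f.across).comp f.down).cons f.back⟩

theorem Vertex.next_spec (k : Vertex Γ w) :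
    (∃ l : Vertex Γ w, l.str = k.str ∧ k.pos < l.pos ∧ l.pos = k.next) ∨
      k.next = w.length + 1 := by
  have h := Nat.sInf_mem (s := {n | ∃ l : Vertex Γ w, l.str = k.str ∧ k.pos < l.pos ∧ l.pos = n} ∪
    {w.length + 1}) ⟨_, Or.inr rfl⟩
  exact h

theorem Vertex.next_le {k l : Vertex Γ w} (h : l.str = k.str) (h' : k.pos < l.pos) :
    k.next ≤ l.pos :=
  Nat.sInf_le (Or.inl ⟨l, h, h', rfl⟩)

theorem Vertex.pos_le (k : Vertex Γ w) : k.pos ≤ w.length := by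
  cases k with
  | initial i => exact Nat.zero_le _
  | letter k => exact k.2

theorem Vertex.ext_pos {k l : Vertex Γ w} (h : k.str = l.str) (h' : k.pos = l.pos) : k = l := by
  cases k <;> cases l <;> simp_all [str, pos, Fin.ext_iff]

theorem Vertex.eq_of_pos_pos {k l : Vertex Γ w} (h : 0 < k.pos) (h' : k.pos = l.pos) : k = l := by
  cases k <;> cases l <;> simp_all [pos, Fin.ext_iff]

theorem Vertex.str_of_pos_eq_next {k l : Vertex Γ w} (h : l.pos = k.next) :
    l.str = k.str ∧ k.pos < l.pos := by
  rcases k.next_spec with ⟨m, hm, hm', hm''⟩ | h'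
  · have : l = m := Vertex.eq_of_pos_pos (by omega) (by omega)
    subst this
    exact ⟨hm, hm'⟩
  · have := l.pos_le
    omega

theorem Vertex.eq_of_next {k k' l : Vertex Γ w} (h : l.pos = k.next) (h' : l.pos = k'.next) :
    k = k' := by
  obtain ⟨h1, h2⟩ := str_of_pos_eq_next h
  obtain ⟨h1', h2'⟩ := str_of_pos_eq_next h'
  rcases lt_trichotomy k.pos k'.pos with hlt | heq | hlt
  · have := next_le (h1'.symm.trans h1) hlt
    omega
  · exact ext_pos (h1.symm.trans h1') heq
  · have := next_le (h1.symm.trans h1') hlt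
    omega

theorem up_pos_le {s t : Vertex Γ w} (p : Path s t) (h : QP.AllArrows IsUp p) :
    s.pos ≤ t.pos := by
  induction p with
  | nil => exact le_rfl
  | cons p e ih => exact (ih h.1).trans (str_of_pos_eq_next h.2.1).2.le

theorem down_pos_le {s t : Vertex Γ w} (p : Path s t) (h : QP.AllArrows IsDown p) :
    t.pos ≤ s.pos := by
  induction p with
  | nil => exact le_rfl
  | cons p e ih => exact (str_of_pos_eq_next h.2.1).2.le.trans (ih h.1)

theorem up_unique {s t : Vertex Γ w} (p q : Path s t) (hp : QP.AllArrows IsUp p)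
    (hq : QP.AllArrows IsUp q) : p = q := by
  induction p with
  | nil =>
    cases q with
    | nil => rfl
    | cons q e =>
      have := up_pos_le q hq.1
      have := (str_of_pos_eq_next hq.2.1).2
      omega
  | cons p e ih =>
    cases q with
    | nil =>
      have := up_pos_le p hp.1
      have := (str_of_pos_eq_next hp.2.1).2
      omega
    | cons q e' =>
      have := eq_of_next hp.2.1 hq.2.1
      subst this
      rw [ih q hp.1 hq.1, Subsingleton.elim e e']

theorem down_unique {s t : Vertex Γ w} (p q : Path s t) (hp : QP.AllArrows IsDown p)
    (hq : QP.AllArrows IsDown q) : p = q := by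
  induction p with
  | nil =>
    cases q with
    | nil => rfl
    | cons q e =>
      have := down_pos_le q hq.1
      have := (str_of_pos_eq_next hq.2.1).2
      omega
  | cons p e ih =>
    cases q with
    | nil =>
      have := down_pos_le p hp.1
      have := (str_of_pos_eq_next hp.2.1).2
      omega
    | cons q e' =>
      have h1 := hp.2.1
      have h2 := hq.2.1
      have := eq_of_pos_pos (by have := (str_of_pos_eq_next h1).2; omega) (h1.trans h2.symm)
      subst this
      rw [ih q hp.1 hq.1, Subsingleton.elim e e']

/-- A face is determined by its four corners, so there are only finitely many faces. -/
instance [Finite I] : Finite (Face Γ w) :=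
  Finite.of_injective (fun f : Face Γ w => (f.a, f.a', f.b, f.b')) (by
    rintro ⟨a, a', b, b', h1, p, e, q, d, h2, h3, h4⟩ ⟨a₁, a₁', b₁, b₁', k1, p₁, e₁, q₁, d₁, k2, k3,
      k4⟩ h
    simp only [Prod.mk.injEq] at h
    obtain ⟨rfl, rfl, rfl, rfl⟩ := h
    obtain rfl := up_unique p p₁ h2 k2
    obtain rfl := down_unique q q₁ h3 k3
    obtain rfl := Subsingleton.elim e e₁
    obtain rfl := Subsingleton.elim d d₁
    rfl)

noncomputable instance [Finite I] : Fintype (Face Γ w) := Fintype.ofFinite _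

/-- `left` describes how each strip is drawn in the plane: for each edge `{i, j}` of `Γ` exactly one
of the strings `i`, `j` is the left one. -/
def IsDrawing (Γ : SimpleGraph I) (left : I → I → Prop) : Prop :=
  ∀ i j, Γ.Adj i j → (left i j ↔ ¬ left j i)

open Classical in
/-- The superpotential: the sum of the clockwise oriented faces minus the sum of the anti-clockwise
oriented faces.  A face whose boundary runs up the string `i` and down the string `j` is
clockwise if `i` is drawn to the left of `j`, and anti-clockwise otherwise. -/
noncomputable def superpotential [Finite I] (Γ : SimpleGraph I) (w : List (I × ℤˣ))
    (left : I → I → Prop) : QP.Potential (Vertex Γ w) :=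
  ∑ f : Face Γ w, Finsupp.single f.cycle (if left f.a.str f.b.str then 1 else -1)

end BFZ

/-! ### Paths and arrow weights in a quiver -/

namespace QP

universe v₁ u₁

variable {Q : Type u₁} [Quiver.{v₁} Q]

/-! Modulo rotations and the Jacobian ideal, every cycle can be pushed down to nothing. Let `f` be a
face with upper arrow `f.across` and lower arrow `f.back`. A face is determined by its lower arrow
(`Face.eq_of_back`), so in the cyclic derivative of the superpotential by `f.back` the path `up ·
across · down` of `f` has coefficient ±1, and every other term comes from a face that has `f.back`
as its upper arrow. Such a term crosses between strings only once, and lower than `f.across`. With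
the sum of the heights of the crossings as weight, a cycle containing `up · across · down` is thus
equivalent to a combination of cycles of smaller weight (`Face.single_mem_trivialCycles`), and
strong induction on the weight applies.

It remains to find such a piece in every cycle (`exists_face`). Among its crossings take `a' → b'`
whose face begins as high as possible (`rank`). Between the height `start a' b'` and the crossing,
the string of `a'` has only upward arrows and the string of `b'` only downward ones. A path leaving
the string of `b'` before it has descended to the lower corner would use a crossing with larger
`start`, because the letters of sign -1 just passed count for it; dually for a path arriving at
`a'`. So the cycle contains the whole boundary of the face except the lower arrow. Cycles without
crossings above the bottom do not exist: paths along a string are monotone, and the bottom arrows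
lie over a forest (`no_bottom_cycle`). -/

theorem allArrows_comp {R : Q → Q → Prop} {s t : Q} (p : Path s t) {r : Q} (q : Path t r) :
    AllArrows R (p.comp q) ↔ AllArrows R p ∧ AllArrows R q := by
  induction q with
  | nil => simp [AllArrows]
  | cons q e ih => simp only [Path.comp_cons, AllArrows, ih, and_assoc]

theorem AllArrows.mono {R R' : Q → Q → Prop} (h : ∀ x y : Q, (x ⟶ y) → R x y → R' x y) {s t : Q}
    {p : Path s t} (hp : AllArrows R p) : AllArrows R' p := by
  induction p with
  | nil => trivial
  | cons p e ih => exact ⟨ih hp.1, h _ _ e hp.2⟩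

/-- The sum of the weights of the arrows of a path. -/
def arrowSum (g : Q → Q → ℕ) {s : Q} : ∀ {t : Q}, Path s t → ℕ
  | _, .nil => 0
  | _, .cons (b := b) (c := t) p _ => arrowSum g p + g b t

theorem arrowSum_comp (g : Q → Q → ℕ) {s t : Q} (p : Path s t) {r : Q} (q : Path t r) :
    arrowSum g (p.comp q) = arrowSum g p + arrowSum g q := by
  induction q with
  | nil => simp [arrowSum]
  | cons q e ih => simp only [Path.comp_cons, arrowSum, ih, add_assoc]

theorem arrowSum_eq_zero {g : Q → Q → ℕ} {s t : Q} {p : Path s t}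
    (hp : AllArrows (fun x y => g x y = 0) p) : arrowSum g p = 0 := by
  induction p with
  | nil => rfl
  | cons p e ih => simp [arrowSum, ih hp.1, hp.2]

/-- A path of positive length passes through an arrow of maximal weight. -/
theorem exists_max_arrow (g : Q → Q → ℕ) {s t : Q} (p : Path s t) (hp : 0 < p.length) :
    ∃ (x y : Q) (p₁ : Path s x) (e : x ⟶ y) (p₂ : Path y t), p = (p₁.cons e).comp p₂ ∧
      AllArrows (fun k l => g k l ≤ g x y) p₁ ∧ AllArrows (fun k l => g k l ≤ g x y) p₂ := by
  induction p with
  | nil => simp at hp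
  | cons p e ih =>
    rename_i b c
    rcases Nat.eq_zero_or_pos p.length with h0 | h0
    · obtain rfl := Path.eq_of_length_zero p h0
      obtain rfl := Path.eq_nil_of_length_zero p h0
      exact ⟨_, _, Path.nil, e, Path.nil, rfl, trivial, trivial⟩
    · obtain ⟨x, y, p₁, e₁, p₂, rfl, h1, h2⟩ := ih h0
      rcases le_total (g b c) (g x y) with h | h
      · exact ⟨x, y, p₁, e₁, p₂.cons e, rfl, h1, h2, h⟩
      · refine ⟨b, c, (p₁.cons e₁).comp p₂, e, Path.nil, rfl, ?_, trivial⟩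
        rw [allArrows_comp]
        exact ⟨⟨h1.mono fun _ _ _ h' => h'.trans h, h⟩, h2.mono fun _ _ _ h' => h'.trans h⟩

/-! ### Occurrences of an arrow, rotations, and relations from cyclic derivatives -/

theorem comp_of_mem_splits {x y : Q} (a : x ⟶ y) {s t : Q} (p : Path s t)
    (z : Path s x × Path y t) (hz : z ∈ splits a p) : (z.1.cons a).comp z.2 = p := by
  induction p with
  | nil => simp [splits] at hz
  | cons p e ih =>
    rw [splits, List.mem_append] at hz
    rcases hz with hz | hz
    · obtain ⟨z', hz', rfl⟩ := List.mem_map.1 hz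
      rw [Path.comp_cons, ih z' hz']
    · split_ifs at hz with h
      · obtain ⟨hb, ht, rfl⟩ := h
        subst hb ht
        obtain rfl := List.mem_singleton.1 hz
        rfl
      · simp at hz

theorem splits_cons_self {s x y : Q} (p : Path s x) (a : x ⟶ y)
    (hp : AllArrows (fun k l => ¬(k = x ∧ l = y)) p) :
    splits a (p.cons a) = [(p, Path.nil)] := by
  have h : splits a p = [] := by
    rw [List.eq_nil_iff_forall_not_mem]
    intro z hz
    rw [← comp_of_mem_splits a p z hz, allArrows_comp] at hp
    exact hp.1.2 ⟨rfl, rfl⟩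
  rw [splits, h, dif_pos ⟨rfl, rfl, rfl⟩]
  rfl

/-- The potentials that are cyclically equivalent to an element of the Jacobian ideal by finitely
many rotations. -/
noncomputable def trivialCycles (S : Potential Q) : Submodule ℂ (Potential Q) :=
  jacobianCycles S ⊔ rotationSpan Q

theorem isRigid_of_mem_trivialCycles {S : Potential Q}
    (h : ∀ c : ClosedPath Q, 0 < c.2.length → Finsupp.single c 1 ∈ trivialCycles S) :
    IsRigid S := by
  intro c hc
  obtain ⟨j, hj, z, hz, h⟩ := Submodule.mem_sup.1 (h c hc)
  -- One finite combination of rotations serves for all `n`: the remainder is zero.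
  refine ⟨j, hj, fun n => ⟨z, hz, fun c' hcn => ?_⟩⟩
  rw [← h] at hcn
  simp at hcn

/-- Rotating by a whole path is a telescoping sum of rotations by single arrows. -/
theorem rotate_mem {x y : Q} (p : Path x y) (q : Path y x) :
    (Finsupp.single ⟨x, p.comp q⟩ 1 - Finsupp.single ⟨y, q.comp p⟩ 1 : Potential Q) ∈
      rotationSpan Q := by
  induction p with
  | nil => simp
  | cons p e ih =>
    have h1 := ih (e.toPath.comp q)
    have h2 : (Finsupp.single ⟨_, e.toPath.comp (q.comp p)⟩ 1 -
        Finsupp.single ⟨_, (q.comp p).cons e⟩ 1 : Potential Q) ∈ rotationSpan Q :=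
      Submodule.subset_span ⟨_, _, e, q.comp p, rfl⟩
    have h3 := Submodule.add_mem _ h1 h2
    rw [Path.comp_assoc, sub_add_sub_cancel, ← Path.comp_assoc] at h3
    exact h3

theorem single_mem_trivialCycles_rotate {S : Potential Q} {x y : Q} (p : Path x y) (q : Path y x)
    (h : (Finsupp.single ⟨y, q.comp p⟩ 1 : Potential Q) ∈ trivialCycles S) :
    (Finsupp.single ⟨x, p.comp q⟩ 1 : Potential Q) ∈ trivialCycles S := by
  have hrot := Submodule.add_mem _ (Submodule.mem_sup_right (S := jacobianCycles S) (rotate_mem p q)) h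
  rwa [sub_add_cancel] at hrot

/-- The linear map `z ↦ r z`, from paths parallel to the inverse of `r` to cycles. -/
noncomputable def closeWith {x y : Q} (r : Path x y) : (Path y x →₀ ℂ) →ₗ[ℂ] Potential Q :=
  Finsupp.lmapDomain ℂ ℂ fun z => ⟨x, r.comp z⟩

theorem closeWith_single {x y : Q} (r : Path x y) (z : Path y x) (k : ℂ) :
    closeWith r (Finsupp.single z k) = Finsupp.single ⟨x, r.comp z⟩ k := by
  simp [closeWith]

theorem closeWith_cyclicDeriv_mem (S : Potential Q) {x y : Q} (a : x ⟶ y) (r : Path x y) :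
    closeWith r (cyclicDeriv a S) ∈ trivialCycles S := by
  refine Submodule.mem_sup_left (Submodule.mem_iSup_of_mem x ?_)
  refine ⟨(cyclicDeriv a S).mapDomain fun z => r.comp z, ?_, ?_⟩
  · exact Submodule.subset_span ⟨x, y, a, r, Path.nil, rfl⟩
  · simp only [closeWith, Finsupp.lmapDomain_apply]
    rw [← Finsupp.mapDomain_comp]
    rfl

theorem closeWith_cyclicDerivPath {x y : Q} (a : x ⟶ y) (r : Path x y) (c : ClosedPath Q) :
    closeWith r (cyclicDerivPath a c) =
      ((splits a c.2).map fun z => Finsupp.single ⟨x, r.comp (z.2.comp z.1)⟩ (1 : ℂ)).sum := by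
  rw [cyclicDerivPath, map_list_sum, List.map_map]
  congr 1
  refine List.map_congr_left fun z _ => ?_
  simp [closeWith_single]

/-- If `c = p a` is the only cycle of the potential that is not known to become trivial when its
arrow `a` is replaced by the parallel path `r`, then `p r` is trivial as well. -/
theorem single_mem_trivialCycles_of_sum {ι : Type*} [Fintype ι] (c : ι → ClosedPath Q) (k : ι → ℂ)
    (f : ι) (hf : k f ≠ 0) {x y : Q} (a : x ⟶ y) (p : Path y x) (r : Path x y)
    (hc : c f = ⟨y, p.cons a⟩) (hp : AllArrows (fun k l => ¬(k = x ∧ l = y)) p)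
    (h : ∀ f', f' ≠ f → ∀ z ∈ splits a (c f').2,
      (Finsupp.single ⟨x, r.comp (z.2.comp z.1)⟩ 1 : Potential Q) ∈
        trivialCycles (∑ f, Finsupp.single (c f) (k f))) :
    (Finsupp.single ⟨x, r.comp p⟩ 1 : Potential Q) ∈
      trivialCycles (∑ f, Finsupp.single (c f) (k f)) := by
  classical
  set S : Potential Q := ∑ f, Finsupp.single (c f) (k f) with hS
  have h1 := closeWith_cyclicDeriv_mem S a r
  have h2 : closeWith r (cyclicDeriv a S) =
      ∑ f', k f' • closeWith r (cyclicDerivPath a (c f')) := by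
    rw [hS, map_sum, map_sum]
    refine Finset.sum_congr rfl fun f' _ => ?_
    rw [cyclicDeriv, Finsupp.linearCombination_single, map_smul]
  rw [h2, ← Finset.add_sum_erase _ _ (Finset.mem_univ f)] at h1
  have h3 : ∑ f' ∈ Finset.univ.erase f, k f' • closeWith r (cyclicDerivPath a (c f')) ∈
      trivialCycles S := by
    refine Submodule.sum_mem _ fun f' hf' => Submodule.smul_mem _ _ ?_
    rw [closeWith_cyclicDerivPath]
    refine list_sum_mem fun u hu => ?_
    obtain ⟨z, hz, rfl⟩ := List.mem_map.1 hu
    exact h f' (Finset.ne_of_mem_erase hf') z hz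
  -- The whole sum and all terms but that of `f` are trivial. In `c f` the arrow `a` occurs once, so
  -- the remaining term is a nonzero multiple of `r p`.
  have h4 := (Submodule.add_mem_iff_left _ h3).1 h1
  rw [Submodule.smul_mem_iff _ hf, closeWith_cyclicDerivPath, hc, splits_cons_self p a hp] at h4
  simpa using h4

end QP

/-! ### Strings and the arrows crossing between them -/

namespace BFZ

universe u

variable {I : Type u} {Γ : SimpleGraph I} {w : List (I × ℤˣ)}

namespace Vertex

theorem pos_lt_next (k : Vertex Γ w) : k.pos < k.next := by
  have := k.pos_le
  rcases k.next_spec with ⟨l, -, h, h'⟩ | h <;> omega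

theorem pos_le_of_lt_next {k l : Vertex Γ w} (h : k.str = l.str) (h' : k.pos < l.next) :
    k.pos ≤ l.pos := by
  by_contra! hlt
  have := next_le h hlt
  omega

/-- On each string there is at most one vertex that is the last one up to a given height. -/
theorem eq_of_current {k l : Vertex Γ w} {n : ℕ} (h : k.str = l.str) (h1 : k.pos ≤ n)
    (h2 : n < k.next) (h3 : l.pos ≤ n) (h4 : n < l.next) : k = l :=
  ext_pos h (le_antisymm (pos_le_of_lt_next h (by omega)) (pos_le_of_lt_next h.symm (by omega)))

theorem exists_current (i : I) {n : ℕ} (hn : n ≤ w.length) :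
    ∃ k : Vertex Γ w, k.str = i ∧ k.pos ≤ n ∧ n < k.next := by
  induction n with
  | zero => exact ⟨initial i, rfl, le_rfl, pos_lt_next (initial i : Vertex Γ w)⟩
  | succ n ih =>
    obtain ⟨k, hk, h1, h2⟩ := ih (by omega)
    rcases Nat.lt_or_ge (n + 1) k.next with h | h
    · exact ⟨k, hk, by omega, h⟩
    · rcases k.next_spec with ⟨l, hl, -, hl'⟩ | h'
      · exact ⟨l, hl.trans hk, by omega, by have := l.pos_lt_next; omega⟩
      · omega

/-- The vertical arrows, along a string. -/
def IsVert (k l : Vertex Γ w) : Prop := IsUp k l ∨ IsDown k l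

theorem IsVert.str_eq {k l : Vertex Γ w} (h : IsVert k l) : k.str = l.str := by
  rcases h with h | h
  · exact (str_of_pos_eq_next h.1).1.symm
  · exact (str_of_pos_eq_next h.1).1

theorem IsUp.lt {k l : Vertex Γ w} (h : IsUp k l) : k.pos < l.pos := (str_of_pos_eq_next h.1).2

theorem IsDown.lt {k l : Vertex Γ w} (h : IsDown k l) : l.pos < k.pos := (str_of_pos_eq_next h.1).2

/-- A uniform description of the arrows `k → l` between different strings: `k` and `l` are the last
vertices of their strings up to a common height; the last letter below this height lies on the
string of `k` and has sign `1`, or it lies on the string of `l` and has sign `-1`; and for the next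
letter it is the other way round. -/
structure IsCross (k l : Vertex Γ w) : Prop where
  adj : Γ.Adj k.str l.str
  lt_next : k.pos < l.next
  lt_next' : l.pos < k.next
  below : (k.pos = 0 ∧ l.pos = 0) ∨ (l.pos < k.pos ∧ k.sgn = 1) ∨ (k.pos < l.pos ∧ l.sgn = -1)
  above : (∃ m : Vertex Γ w, m.pos = k.next ∧ k.next < l.next ∧ m.sgn = -1) ∨
    (∃ m : Vertex Γ w, m.pos = l.next ∧ l.next < k.next ∧ m.sgn = 1) ∨
    (k.next = w.length + 1 ∧ l.next = w.length + 1 ∧ (0 < k.pos ∨ 0 < l.pos))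

theorem not_sgn {k : Vertex Γ w} (h : k.sgn = 1) : k.sgn ≠ -1 := by
  rw [h]; decide

/-- The condition `below` records which end is higher and the resulting direction (or that the arrow
is at the bottom); `above` merges the cases for the next letter. This form makes lower and upper
arrows of a face directly comparable. -/
theorem isArrow_iff_isCross {k l : Vertex Γ w} (h : Γ.Adj k.str l.str) :
    IsArrow k l ↔ IsCross k l := by
  have hk := k.pos_lt_next
  have hl := l.pos_lt_next
  constructor
  · rintro (h1 | h1 | ⟨⟨-, h1, h2⟩, h3⟩ | ⟨⟨-, h1, h2⟩, h3⟩ | ⟨m, ⟨-, h1, h2, h4, h5⟩, h3⟩ |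
      ⟨m, ⟨-, h1, h2, h4, h5⟩, h3⟩)
    · exact absurd (IsVert.str_eq (.inl h1)) h.ne
    · exact absurd (IsVert.str_eq (.inr h1)) h.ne
    · rcases h2 with ⟨h2, h4, m, hm, hm'⟩ | ⟨h2, m, hm, hm'⟩ | ⟨h2, h4⟩
      · exact ⟨h, by omega, h2, .inr (.inr ⟨h1, h3⟩), .inl ⟨m, hm, h4, hm'.trans h3⟩⟩
      · exact ⟨h, by omega, by omega, .inr (.inr ⟨h1, h3⟩),
          .inr (.inl ⟨m, hm, h2, by rw [hm', h3, neg_neg]⟩)⟩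
      · exact ⟨h, by omega, by omega, .inr (.inr ⟨h1, h3⟩), .inr (.inr ⟨h2, h4, by omega⟩)⟩
    · rcases h2 with ⟨h2, h4, m, hm, hm'⟩ | ⟨h2, m, hm, hm'⟩ | ⟨h2, h4⟩
      · exact ⟨h, by omega, by omega, .inr (.inl ⟨h1, h3⟩), .inr (.inl ⟨m, hm, h4, hm'.trans h3⟩)⟩
      · exact ⟨h, by omega, by omega, .inr (.inl ⟨h1, h3⟩), .inl ⟨m, hm, h2, by rw [hm', h3]⟩⟩
      · exact ⟨h, by omega, by omega, .inr (.inl ⟨h1, h3⟩), .inr (.inr ⟨h4, h2, by omega⟩)⟩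
    · exact ⟨h, by omega, by omega, .inl ⟨h1, h2⟩, .inl ⟨m, h5, h4, h3⟩⟩
    · exact ⟨h, by omega, by omega, .inl ⟨h2, h1⟩, .inr (.inl ⟨m, h5, h4, h3⟩)⟩
  · rintro ⟨-, h1, h2, h3 | h3 | h3, h4⟩
    · rcases h4 with ⟨m, h4, h5, h6⟩ | ⟨m, h4, h5, h6⟩ | h4
      · exact .inr (.inr (.inr (.inr (.inl ⟨m, ⟨h, h3.1, h3.2, h5, h4⟩, h6⟩))))
      · exact .inr (.inr (.inr (.inr (.inr ⟨m, ⟨h.symm, h3.2, h3.1, h5, h4⟩, h6⟩))))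
      -- Two strings without letters have no arrow between them, which is why the last case of
      -- `above` asks for a positive position.
      · omega
    · refine .inr (.inr (.inr (.inl ⟨⟨h.symm, h3.1, ?_⟩, h3.2⟩)))
      rcases h4 with ⟨m, h4, h5, h6⟩ | ⟨m, h4, h5, h6⟩ | h4
      · exact .inr (.inl ⟨h5, m, h4, by rw [h6, h3.2]⟩)
      · exact .inl ⟨h1, h5, m, h4, h6.trans h3.2.symm⟩
      · exact .inr (.inr ⟨h4.2.1, h4.1⟩)
    · refine .inr (.inr (.inl ⟨⟨h, h3.1, ?_⟩, h3.2⟩))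
      rcases h4 with ⟨m, h4, h5, h6⟩ | ⟨m, h4, h5, h6⟩ | h4
      · exact .inl ⟨h2, h5, m, h4, h6.trans h3.2.symm⟩
      · exact .inr (.inl ⟨h5, m, h4, by rw [h6, h3.2, neg_neg]⟩)
      · exact .inr (.inr ⟨h4.1, h4.2.1⟩)

theorem IsArrow.isVert_or_isCross {k l : Vertex Γ w} (h : IsArrow k l) :
    IsVert k l ∨ IsCross k l := by
  have h' := h
  rcases h with h1 | h1 | h1 | h1 | ⟨m, h1, -⟩ | ⟨m, h1, -⟩
  · exact .inl (.inl h1)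
  · exact .inl (.inr h1)
  · exact .inr ((isArrow_iff_isCross h1.1.1).1 h')
  · exact .inr ((isArrow_iff_isCross h1.1.1.symm).1 h')
  · exact .inr ((isArrow_iff_isCross h1.1).1 h')
  · exact .inr ((isArrow_iff_isCross h1.1.symm).1 h')

/-- The higher end, or at the bottom the first letter above, would need both signs. -/
theorem IsCross.not_symm {k l : Vertex Γ w} (h : IsCross k l) : ¬ IsCross l k := by
  intro h'
  rcases h.below with h1 | h1 | h1
  · rcases h.above with ⟨m, h2, h3, h4⟩ | ⟨m, h2, h3, h4⟩ | h2
    · rcases h'.above with ⟨m', h2', h3', h4'⟩ | ⟨m', h2', h3', h4'⟩ | h2'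
      · omega
      · have := k.pos_lt_next
        obtain rfl := eq_of_pos_pos (k := m) (l := m') (by omega) (by omega)
        exact not_sgn h4' h4
      · omega
    · rcases h'.above with ⟨m', h2', h3', h4'⟩ | ⟨m', h2', h3', h4'⟩ | h2'
      · have := l.pos_lt_next
        obtain rfl := eq_of_pos_pos (k := m) (l := m') (by omega) (by omega)
        exact not_sgn h4 h4'
      · omega
      · omega
    · omega
  · rcases h'.below with h2 | h2 | h2
    · omega
    · omega
    · exact not_sgn h1.2 h2.2
  · rcases h'.below with h2 | h2 | h2
    · omega
    · exact not_sgn h2.2 h1.2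
    · omega

/-! ### Heights of arrows and the region of the face below an arrow -/

open Classical in
/-- The height of an arrow between different strings; arrows along strings have weight `0`. -/
noncomputable def weight (k l : Vertex Γ w) : ℕ := if k.str = l.str then 0 else max k.pos l.pos

theorem IsVert.weight_eq {k l : Vertex Γ w} (h : IsVert k l) : weight k l = 0 := if_pos h.str_eq

theorem weight_of_adj {k l : Vertex Γ w} (h : Γ.Adj k.str l.str) :
    weight k l = max k.pos l.pos := if_neg h.ne

/-- The height at which the face below an arrow `k → l` between different strings begins: the last
height below the arrow of a letter with sign `-1` on the string of `k`, or with sign `1` on the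
string of `l`. -/
noncomputable def start (k l : Vertex Γ w) : ℕ :=
  sSup {n | ∃ q : Vertex Γ w, q.pos = n ∧ n ≤ max k.pos l.pos ∧
    ((q.str = k.str ∧ q.sgn = -1) ∨ (q.str = l.str ∧ q.sgn = 1))}

theorem le_start {k l q : Vertex Γ w} (h : q.pos ≤ max k.pos l.pos)
    (h' : (q.str = k.str ∧ q.sgn = -1) ∨ (q.str = l.str ∧ q.sgn = 1)) : q.pos ≤ start k l :=
  le_csSup ⟨max k.pos l.pos, fun _ ⟨_, _, h, _⟩ => h⟩ ⟨q, rfl, h, h'⟩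

theorem start_spec (k l : Vertex Γ w) : ∃ q : Vertex Γ w, q.pos = start k l ∧
    start k l ≤ max k.pos l.pos ∧
      ((q.str = k.str ∧ q.sgn = -1) ∨ (q.str = l.str ∧ q.sgn = 1)) :=
  Nat.sSup_mem (s := {n | ∃ q : Vertex Γ w, q.pos = n ∧ n ≤ max k.pos l.pos ∧
    ((q.str = k.str ∧ q.sgn = -1) ∨ (q.str = l.str ∧ q.sgn = 1))})
    -- The initial index of the tail string has sign -1 by convention, so the supremum is attained.
    ⟨0, initial k.str, rfl, Nat.zero_le _, .inl ⟨rfl, rfl⟩⟩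
    ⟨max k.pos l.pos, fun _ ⟨_, _, h, _⟩ => h⟩

/-- The higher end of the arrow has sign 1 if it is the tail and -1 if it is the head, so it is not
among the letters counted by `start`. -/
theorem start_lt {k l : Vertex Γ w} (h : IsCross k l) (h0 : 0 < max k.pos l.pos) :
    start k l < max k.pos l.pos := by
  obtain ⟨q, h1, h2, h3⟩ := start_spec k l
  refine lt_of_le_of_ne h2 fun heq => ?_
  rcases h.below with h4 | ⟨h4, h5⟩ | ⟨h4, h5⟩
  · omega
  · obtain rfl := eq_of_pos_pos (k := q) (l := k) (by omega) (by omega)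
    exact h3.elim (fun h3 => not_sgn h5 h3.2) fun h3 => h.adj.ne h3.1
  · obtain rfl := eq_of_pos_pos (k := q) (l := l) (by omega) (by omega)
    exact h3.elim (fun h3 => h.adj.ne h3.1.symm) fun h3 => not_sgn h3.2 h5

/-- By maximality of `start`. Together with `sgn_head` it makes the sides of the region run up the
tail string and down the head string. -/
theorem sgn_tail {k l q : Vertex Γ w} (hq : q.str = k.str) (h : start k l < q.pos)
    (h' : q.pos ≤ max k.pos l.pos) : q.sgn = 1 := by
  by_contra hs
  have := le_start h' (.inl ⟨hq, (Int.units_eq_one_or _).resolve_left hs⟩)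
  omega

theorem sgn_head {k l q : Vertex Γ w} (hq : q.str = l.str) (h : start k l < q.pos)
    (h' : q.pos ≤ max k.pos l.pos) : q.sgn = -1 := by
  by_contra hs
  have := le_start h' (.inr ⟨hq, (Int.units_eq_one_or _).resolve_right hs⟩)
  omega

/-- At the height where the face below an arrow begins, there is an arrow in the opposite
direction. -/
theorem isCross_start {a b a' b' : Vertex Γ w} (h : IsCross a' b') (h0 : 0 < max a'.pos b'.pos)
    (ha : a.str = a'.str) (ha1 : a.pos ≤ start a' b') (ha2 : start a' b' < a.next)
    (hb : b.str = b'.str) (hb1 : b.pos ≤ start a' b') (hb2 : start a' b' < b.next) :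
    IsCross b a := by
  have hadj : Γ.Adj b.str a.str := by rw [ha, hb]; exact h.adj.symm
  have hlt := start_lt h h0
  have hle : max a'.pos b'.pos ≤ w.length := max_le a'.pos_le b'.pos_le
  refine ⟨hadj, by omega, by omega, ?_, ?_⟩
  · obtain ⟨q, h1, h2, h3⟩ := start_spec a' b'
    rcases Nat.eq_zero_or_pos (start a' b') with hs | hs
    · exact .inl (by omega)
    · right
      -- The letter at height `start` is `a` or `b` itself, and its sign is the one required for an
      -- arrow `b → a`.
      have hq := q.pos_lt_next
      rcases h3 with h3 | h3
      · obtain rfl : q = a := eq_of_current (n := start a' b') (h3.1.trans ha.symm) (by omega)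
          (by omega) ha1 ha2
        refine .inr ⟨lt_of_le_of_ne (by omega) fun heq => ?_, h3.2⟩
        obtain rfl := eq_of_pos_pos (k := b) (l := q) (by omega) heq
        exact hadj.ne rfl
      · obtain rfl : q = b := eq_of_current (n := start a' b') (h3.1.trans hb.symm) (by omega)
          (by omega) hb1 hb2
        refine .inl ⟨lt_of_le_of_ne (by omega) fun heq => ?_, h3.2⟩
        obtain rfl := eq_of_pos_pos (k := a) (l := q) (by omega) heq
        exact hadj.ne rfl
  -- The higher end of the upper arrow lies above `start`, so a next letter exists within the
  -- region, where its sign is prescribed.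
  · have hmin : min b.next a.next ≤ max a'.pos b'.pos := by
      rcases le_total a'.pos b'.pos with hm | hm
      · have := next_le hb.symm (show b.pos < b'.pos by omega)
        omega
      · have := next_le ha.symm (show a.pos < a'.pos by omega)
        omega
    rcases lt_trichotomy b.next a.next with hc | hc | hc
    · rcases b.next_spec with ⟨m, hm, -, hm'⟩ | hm
      · exact .inl ⟨m, hm', hc, sgn_head (k := a') (hm.trans hb) (by omega) (by omega)⟩
      · omega
    · rcases b.next_spec with ⟨m, hm, -, hm'⟩ | hm
      · rcases a.next_spec with ⟨n, hn, -, hn'⟩ | hn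
        · obtain rfl := eq_of_pos_pos (k := m) (l := n) (by omega) (by omega)
          exact absurd (hm.symm.trans hn) hadj.ne
        · omega
      · omega
    · rcases a.next_spec with ⟨m, hm, -, hm'⟩ | hm
      · exact .inr (.inl ⟨m, hm', hc, sgn_tail (l := b') (hm.trans ha) (by omega) (by omega)⟩)
      · omega

/-- No arrow between the two strings runs strictly inside the face below an arrow. -/
theorem no_arrow_inside {a b a' b' : Vertex Γ w} (h : IsCross a' b')
    (ha : a.str = a'.str) (ha2 : start a' b' < a.next)
    (hb : b.str = b'.str) (hb2 : start a' b' < b.next)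
    (s t : Vertex Γ w) (hs : s.str = a.str) (ht : t.str = b.str) (h1 : a.pos ≤ s.pos)
    (h2 : s.pos ≤ a'.pos) (h3 : b.pos ≤ t.pos) (h4 : t.pos ≤ b'.pos)
    (hst : IsArrow s t ∨ IsArrow t s) : (s = a ∧ t = b) ∨ (s = a' ∧ t = b') := by
  have hadj : Γ.Adj s.str t.str := by rw [hs, ht, ha, hb]; exact h.adj
  have hle : max a'.pos b'.pos ≤ w.length := max_le a'.pos_le b'.pos_le
  rw [isArrow_iff_isCross hadj, isArrow_iff_isCross hadj.symm] at hst
  by_cases hn : max s.pos t.pos ≤ start a' b'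
  · exact .inl ⟨ext_pos hs (le_antisymm (pos_le_of_lt_next hs (by omega)) h1),
      ext_pos ht (le_antisymm (pos_le_of_lt_next ht (by omega)) h3)⟩
  right
  by_contra hne
  -- One of `s`, `t` is not yet an upper corner, so the next letter on the two strings still lies in
  -- the region.
  have hmin : min s.next t.next ≤ max a'.pos b'.pos := by
    by_cases hs' : s.pos < a'.pos
    · have := next_le (hs.trans ha).symm hs'
      omega
    · have hsa : s = a' := ext_pos (hs.trans ha) (by omega)
      by_cases ht' : t.pos < b'.pos
      · have := next_le (ht.trans hb).symm ht'
        omega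
      · exact absurd ⟨hsa, ext_pos (ht.trans hb) (by omega)⟩ hne
  have hs0 := s.pos_lt_next
  have ht0 := t.pos_lt_next
  rcases hst with hst | hst
  -- An arrow `s → t` is refuted by the sign of the next letter, an arrow `t → s` by the sign of its
  -- own higher end.
  · have h5 := hst.lt_next
    have h6 := hst.lt_next'
    rcases hst.above with ⟨m, hm, hm1, hm2⟩ | ⟨m, hm, hm1, hm2⟩ | hm
    · exact not_sgn (sgn_tail (l := b') ((str_of_pos_eq_next hm).1.trans (hs.trans ha)) (by omega)
        (by omega)) hm2
    · exact not_sgn hm2 (sgn_head (k := a') ((str_of_pos_eq_next hm).1.trans (ht.trans hb))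
        (by omega) (by omega))
    · omega
  · rcases hst.below with h5 | ⟨h5, h6⟩ | ⟨h5, h6⟩
    · omega
    · exact not_sgn h6 (sgn_head (k := a') (ht.trans hb) (by omega) (by omega))
    · exact not_sgn (sgn_tail (l := b') (hs.trans ha) (by omega) (by omega)) h6

end Vertex

end BFZ

/-! ### Paths along one string -/

namespace BFZ

universe u

variable {I : Type u} {Γ : SimpleGraph I} {w : List (I × ℤˣ)}

open Vertex QP

theorem str_eq_of_allArrows {s t : Vertex Γ w} {p : Path s t} (h : AllArrows IsVert p) :
    t.str = s.str := by
  induction p with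
  | nil => rfl
  | cons p e ih => exact h.2.str_eq.symm.trans (ih h.1)

theorem allArrows_isVert_of_isUp {s t : Vertex Γ w} {p : Path s t} (h : AllArrows IsUp p) :
    AllArrows IsVert p := h.mono fun _ _ _ => .inl

theorem allArrows_isVert_of_isDown {s t : Vertex Γ w} {p : Path s t} (h : AllArrows IsDown p) :
    AllArrows IsVert p := h.mono fun _ _ _ => .inr

/-- Paths along a string are monotone. -/
theorem isUp_or_isDown_of_isVert {s t : Vertex Γ w} {p : Path s t} (h : AllArrows IsVert p) :
    AllArrows IsUp p ∨ AllArrows IsDown p := by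
  induction p with
  | nil => exact .inl trivial
  | cons p e ih =>
    cases p with
    | nil => exact h.2.imp (fun h => ⟨trivial, h⟩) fun h => ⟨trivial, h⟩
    | cons p e' =>
      -- The direction of a vertical edge is the sign of its upper end, so at a turn one vertex
      -- would have both signs.
      rcases ih h.1 with h1 | h1 <;> rcases h.2 with h2 | h2
      · exact .inl ⟨h1, h2⟩
      · exact absurd h2.2 (not_sgn h1.2.2)
      · have h3 := eq_of_pos_pos (by have := h2.lt; omega) (h2.1.trans h1.2.1.symm)
        exact absurd h1.2.2 (not_sgn (h3 ▸ h2.2))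
      · exact .inr ⟨h1, h2⟩

/-! ### Faces -/

theorem Face.ext_corners {f g : Face Γ w} (h1 : f.a = g.a) (h2 : f.a' = g.a') (h3 : f.b = g.b)
    (h4 : f.b' = g.b') : f = g := by
  obtain ⟨a, a', b, b', _, p, e, q, d, hp, hq, _⟩ := f
  obtain ⟨c, c', k, k', _, p', e', q', d', hp', hq', _⟩ := g
  obtain rfl : a = c := h1
  obtain rfl : a' = c' := h2
  obtain rfl : b = k := h3
  obtain rfl : b' = k' := h4
  obtain rfl := up_unique p p' hp hp'
  obtain rfl := down_unique q q' hq hq'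
  obtain rfl := Subsingleton.elim e e'
  obtain rfl := Subsingleton.elim d d'
  rfl

theorem Face.str_a' (f : Face Γ w) : f.a'.str = f.a.str :=
  str_eq_of_allArrows (allArrows_isVert_of_isUp f.isUp)

theorem Face.str_b' (f : Face Γ w) : f.b'.str = f.b.str :=
  (str_eq_of_allArrows (allArrows_isVert_of_isDown f.isDown)).symm

theorem Face.adj' (f : Face Γ w) : Γ.Adj f.a'.str f.b'.str := by
  rw [f.str_a', f.str_b']
  exact f.adj

theorem Face.isCross_across (f : Face Γ w) : IsCross f.a' f.b' :=
  (isArrow_iff_isCross f.adj').1 f.across.down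

theorem Face.isCross_back (f : Face Γ w) : IsCross f.b f.a :=
  (isArrow_iff_isCross f.adj.symm).1 f.back.down

theorem Face.corners_ne (f : Face Γ w) : ¬ (f.a' = f.a ∧ f.b' = f.b) := by
  rintro ⟨h1, h2⟩
  have h := f.isCross_across
  rw [h1, h2] at h
  exact h.not_symm f.isCross_back

/-- The sides are monotone. Were the upper arrow no higher than the lower one, both pairs of corners
would be the last vertices of their strings up to a common height, hence equal. -/
theorem Face.weight_back_lt (f : Face Γ w) : weight f.b f.a < weight f.a' f.b' := by
  rw [weight_of_adj f.adj.symm, weight_of_adj f.adj']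
  have h1 := up_pos_le f.up f.isUp
  have h2 := down_pos_le f.down f.isDown
  have h3 := f.isCross_back
  have h4 := f.isCross_across
  have := h3.lt_next
  have := h3.lt_next'
  have := h4.lt_next
  have := h4.lt_next'
  have := f.a.pos_lt_next
  have := f.b.pos_lt_next
  have := f.a'.pos_lt_next
  have := f.b'.pos_lt_next
  by_contra! hle
  exact f.corners_ne
    ⟨eq_of_current (n := max f.b.pos f.a.pos) f.str_a' (by omega) (by omega) (by omega) (by omega),
      eq_of_current (n := max f.b.pos f.a.pos) f.str_b' (by omega) (by omega) (by omega) (by omega)⟩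

/-- The upper arrow of `f` lies in the region of `g`, which has no inner arrows. -/
theorem Face.eq_of_weight_le {f g : Face Γ w} (ha : f.a = g.a) (hb : f.b = g.b)
    (hle : weight f.a' f.b' ≤ weight g.a' g.b') : f = g := by
  rw [weight_of_adj f.adj', weight_of_adj g.adj'] at hle
  have h1 := up_pos_le f.up f.isUp
  have h2 := down_pos_le f.down f.isDown
  have h3 := g.isCross_across
  have := h3.lt_next
  have := h3.lt_next'
  have := g.a'.pos_lt_next
  have := g.b'.pos_lt_next
  have ha' := f.str_a'
  have hb' := f.str_b'
  rcases g.empty f.a' f.b' (ha'.trans (congrArg str ha)) (hb'.trans (congrArg str hb))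
    (ha ▸ h1) (pos_le_of_lt_next (ha'.trans ((congrArg str ha).trans g.str_a'.symm)) (by omega))
    (hb ▸ h2) (pos_le_of_lt_next (hb'.trans ((congrArg str hb).trans g.str_b'.symm)) (by omega))
    (.inl f.across.down) with h | h
  · exact absurd ⟨h.1.trans ha.symm, h.2.trans hb.symm⟩ f.corners_ne
  · exact ext_corners ha h.1 hb h.2

/-- A face is determined by its lower arrow. -/
theorem Face.eq_of_back {f g : Face Γ w} (ha : f.a = g.a) (hb : f.b = g.b) : f = g := by
  rcases le_total (weight f.a' f.b') (weight g.a' g.b') with h | h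
  · exact eq_of_weight_le ha hb h
  · exact (eq_of_weight_le ha.symm hb.symm h).symm

theorem arrowSum_weight_of_isVert {s t : Vertex Γ w} {p : Path s t} (h : AllArrows IsVert p) :
    arrowSum weight p = 0 :=
  arrowSum_eq_zero (h.mono fun _ _ _ h => h.weight_eq)

theorem Face.arrowSum_cycle (f : Face Γ w) :
    arrowSum weight f.cycle.2 = weight f.a' f.b' + weight f.b f.a := by
  simp [Face.cycle, arrowSum, arrowSum_comp,
    arrowSum_weight_of_isVert (allArrows_isVert_of_isUp f.isUp),
    arrowSum_weight_of_isVert (allArrows_isVert_of_isDown f.isDown)]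

theorem Face.allArrows_cycle {f : Face Γ w} {R : Vertex Γ w → Vertex Γ w → Prop}
    (h1 : ∀ k l, IsVert k l → R k l) (h2 : R f.a' f.b') (h3 : R f.b f.a) :
    AllArrows R f.cycle.2 := by
  refine ⟨(allArrows_comp _ _).2 ⟨⟨?_, h2⟩, ?_⟩, h3⟩
  · exact (allArrows_isVert_of_isUp f.isUp).mono fun _ _ _ => h1 _ _
  · exact (allArrows_isVert_of_isDown f.isDown).mono fun _ _ _ => h1 _ _

/-- The cyclic derivative with respect to the lower arrow of a face `f` shows that a cycle through
the other arrows of `f` is trivial, if all cycles of smaller weight are. -/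
theorem Face.single_mem_trivialCycles [Finite I] (f : Face Γ w) (left : I → I → Prop)
    (r : Path f.b f.a)
    (ih : ∀ c : ClosedPath (Vertex Γ w), 0 < c.2.length →
      arrowSum weight c.2 < weight f.a' f.b' + arrowSum weight r →
        Finsupp.single c 1 ∈ trivialCycles (superpotential Γ w left)) :
    (Finsupp.single ⟨f.b, r.comp ((f.up.cons f.across).comp f.down)⟩ 1 :
      Potential (Vertex Γ w)) ∈ trivialCycles (superpotential Γ w left) := by
  classical
  have hvert : ∀ k l : Vertex Γ w, IsVert k l → ¬(k = f.b ∧ l = f.a) := by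
    rintro k l h ⟨rfl, rfl⟩
    exact f.adj.ne h.str_eq.symm
  refine single_mem_trivialCycles_of_sum Face.cycle _ f ?_ f.back _ r rfl ?_ ?_
  · split_ifs <;> simp
  · refine (allArrows_comp _ _).2 ⟨⟨?_, ?_⟩, ?_⟩
    · exact (allArrows_isVert_of_isUp f.isUp).mono fun _ _ _ => hvert _ _
    · rintro ⟨h, -⟩
      exact f.adj.ne (f.str_a'.symm.trans (congrArg str h))
    · exact (allArrows_isVert_of_isDown f.isDown).mono fun _ _ _ => hvert _ _
  · intro g hg z hz
    have h1 := comp_of_mem_splits f.back g.cycle.2 z hz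
    -- Another face through `f.back` can only have it as its upper arrow.
    have h2 : g.a' = f.b ∧ g.b' = f.a := by
      by_contra hne
      have h3 : AllArrows (fun k l => ¬(k = f.b ∧ l = f.a)) g.cycle.2 :=
        Face.allArrows_cycle hvert hne fun h => hg (Face.eq_of_back h.2 h.1)
      rw [← h1, allArrows_comp] at h3
      exact h3.1.2 ⟨rfl, rfl⟩
    have h3 := congrArg (arrowSum weight) h1
    rw [g.arrowSum_cycle, arrowSum_comp, arrowSum, h2.1, h2.2] at h3
    have h4 := g.weight_back_lt
    rw [h2.1, h2.2] at h4
    -- The weights of `g.back`, `f.back = g.across` and `f.across` increase strictly, so the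
    -- induction hypothesis applies to the substituted cycle.
    have h5 := f.weight_back_lt
    refine ih _ ?_ ?_
    · have : r.length ≠ 0 := fun h =>
        f.adj.ne (congrArg str (Path.eq_of_length_zero r h)).symm
      simp only [Path.length_comp]
      omega
    · simp only [arrowSum_comp]
      omega

/-! ### Cycles contain faces -/

open Classical in
/-- Arrows along strings have rank `0`, those at the bottom have rank `1`, and the other ones have
larger rank the higher the face below them begins. -/
noncomputable def rank (k l : Vertex Γ w) : ℕ :=
  if k.str = l.str then 0 else if max k.pos l.pos = 0 then 1 else start k l + 2

theorem rank_of_isCross {k l : Vertex Γ w} (h : IsCross k l) (h0 : 0 < max k.pos l.pos) :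
    rank k l = start k l + 2 := by
  rw [rank, if_neg h.adj.ne, if_neg h0.ne']

theorem rank_of_bottom {k l : Vertex Γ w} (h : IsCross k l) (h0 : max k.pos l.pos = 0) :
    rank k l = 1 := by
  rw [rank, if_neg h.adj.ne, if_pos h0]

theorem rank_pos {k l : Vertex Γ w} (h : IsCross k l) : 0 < rank k l := by
  rw [rank, if_neg h.adj.ne]
  split_ifs <;> omega

/-- A path that starts at the head of an arrow `a' → b'` and uses no arrow of larger rank
runs down the face below this arrow. -/
theorem exists_down {a' b' b z : Vertex Γ w} (h : IsCross a' b') (h0 : 0 < max a'.pos b'.pos)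
    (hb : b.str = b'.str) (hb2 : start a' b' < b.next)
    (hlt : b.pos < b'.pos) (r : Path b' z)
    (hr : AllArrows (fun k l => rank k l ≤ rank a' b') r) :
    (∃ (D : Path b' b) (r' : Path b z), AllArrows IsDown D ∧ r = D.comp r') ∨
      (z.str = b'.str ∧ b.pos < z.pos ∧ AllArrows IsVert r) := by
  induction r with
  | nil => exact .inr ⟨rfl, hlt, trivial⟩
  | cons r g ih =>
    rename_i z z'
    rcases ih hr.1 with ⟨D, r', hD, rfl⟩ | ⟨h1, h2, h3⟩
    · exact .inl ⟨D, r'.cons g, hD, rfl⟩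
    · rcases g.down.isVert_or_isCross with hg | hg
      · have hs := hg.str_eq.symm.trans h1
        rcases Nat.lt_or_ge b.pos z'.pos with h4 | h4
        · exact .inr ⟨hs, h4, h3, hg⟩
        · rcases hg with hg | hg
          · have := hg.lt
            omega
          · obtain rfl : z' = b := ext_pos (hs.trans hb.symm) (le_antisymm h4
              (pos_le_of_lt_next (hb.trans hs.symm) (by have := hg.1; omega)))
            left
            refine ⟨r.cons g, Path.nil, ⟨?_, hg⟩, rfl⟩
            refine (isUp_or_isDown_of_isVert (p := r.cons g) ⟨h3, .inr hg⟩).elim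
              (fun hu => ?_) fun hd => hd.1
            have := hu.2.lt
            have := hg.lt
            omega
      -- A crossing out of the string above `b` would have larger `start`: the lower of `z` and `b'`
      -- is a letter `q` of sign -1 on its tail string, above `start a' b'`.
      · exfalso
        have h4 := next_le (h1.trans hb.symm) h2
        have h5 := next_le hb.symm hlt
        obtain ⟨q, hq1, hq2, hq3, hq4⟩ : ∃ q : Vertex Γ w, q.str = z.str ∧ q.pos ≤ z.pos ∧
            start a' b' < q.pos ∧ q.pos ≤ b'.pos := by
          rcases le_total z.pos b'.pos with h6 | h6
          · exact ⟨z, rfl, le_rfl, by omega, h6⟩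
          · exact ⟨b', h1.symm, h6, by omega, le_rfl⟩
        have h6 := sgn_head (k := a') (hq1.trans h1) hq3 (by omega)
        have h7 := le_start (k := z) (l := z') (q := q) (by omega) (.inl ⟨hq1, h6⟩)
        have h8 := hr.2
        rw [rank_of_isCross h h0, rank_of_isCross hg (by omega)] at h8
        omega

/-- A path that ends at the tail of an arrow `a' → b'` and uses no arrow of larger rank
runs up the face below this arrow. -/
theorem exists_up {a' b' a y z : Vertex Γ w} (h : IsCross a' b') (h0 : 0 < max a'.pos b'.pos)
    (ha : a.str = a'.str) (ha2 : start a' b' < a.next) (hlt : a.pos < a'.pos) (r : Path z y)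
    (hr : AllArrows (fun k l => rank k l ≤ rank a' b') r) (V : Path y a')
    (hV : AllArrows IsVert V) (hy : a.pos < y.pos) :
    (∃ (r' : Path z a) (U : Path a a'), AllArrows IsUp U ∧ r.comp V = r'.comp U) ∨
      z.str = a'.str := by
  induction r with
  | nil => exact .inr (str_eq_of_allArrows hV).symm
  | cons r g ih =>
    rename_i y₀ y
    have h1 : y.str = a'.str := (str_eq_of_allArrows hV).symm
    rcases g.down.isVert_or_isCross with hg | hg
    · have hs := hg.str_eq.trans h1
      -- The path is read backwards; `V` collects the vertical end already read.
      have hV' : AllArrows IsVert (g.toPath.comp V) := (allArrows_comp _ _).2 ⟨⟨trivial, hg⟩, hV⟩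
      rcases Nat.lt_or_ge a.pos y₀.pos with h4 | h4
      · rcases ih hr.1 (g.toPath.comp V) hV' h4 with ⟨r', U, hU, hrU⟩ | h5
        · exact .inl ⟨r', U, hU, hrU ▸ by rw [← Path.comp_assoc]; rfl⟩
        · exact .inr h5
      · rcases hg with hg | hg
        · obtain rfl : y₀ = a := ext_pos (hs.trans ha.symm) (le_antisymm h4
            (pos_le_of_lt_next (ha.trans hs.symm) (by have := hg.1; omega)))
          left
          refine ⟨r, g.toPath.comp V, ?_, by rw [← Path.comp_assoc]; rfl⟩
          refine (isUp_or_isDown_of_isVert hV').resolve_right fun hd => ?_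
          have := down_pos_le _ hd
          omega
        · have := hg.lt
          omega
    -- As in `exists_down`, now with a letter of sign 1 on the head string of `g`.
    · exfalso
      have h4 := next_le (h1.trans ha.symm) hy
      have h5 := next_le ha.symm hlt
      obtain ⟨q, hq1, hq2, hq3, hq4⟩ : ∃ q : Vertex Γ w, q.str = y.str ∧ q.pos ≤ y.pos ∧
          start a' b' < q.pos ∧ q.pos ≤ a'.pos := by
        rcases le_total y.pos a'.pos with h6 | h6
        · exact ⟨y, rfl, le_rfl, by omega, h6⟩
        · exact ⟨a', h1.symm, h6, by omega, le_rfl⟩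
      have h6 := sgn_tail (l := b') (hq1.trans h1) hq3 (by omega)
      have h7 := le_start (k := y₀) (l := y) (q := q) (by omega) (.inr ⟨hq1, h6⟩)
      have h8 := hr.2
      rw [rank_of_isCross h h0, rank_of_isCross hg (by omega)] at h8
      omega

/-- A cycle contains all arrows but the lower one of the face below its arrow of maximal rank. -/
theorem exists_face {a' b' : Vertex Γ w} (e : a' ⟶ b') (h : IsCross a' b')
    (h0 : 0 < max a'.pos b'.pos) (r : Path b' a')
    (hr : AllArrows (fun k l => rank k l ≤ rank a' b') r) :
    ∃ (f : Face Γ w) (r' : Path f.b f.a) (ha : a' = f.a') (hb : b' = f.b'),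
      r.cast hb ha = (f.down.comp r').comp f.up := by
  have hn : start a' b' ≤ w.length :=
    (start_lt h h0).le.trans (max_le a'.pos_le b'.pos_le)
  -- The lower corners are the last vertices of the two strings up to the height `start a' b'`.
  obtain ⟨a, ha, ha1, ha2⟩ := exists_current (Γ := Γ) a'.str hn
  obtain ⟨b, hb, hb1, hb2⟩ := exists_current (Γ := Γ) b'.str hn
  have hs := start_lt h h0
  have := h.lt_next
  have := h.lt_next'
  have := a'.pos_lt_next
  have := b'.pos_lt_next
  have hale := pos_le_of_lt_next (k := a) (l := a') ha (by omega)
  have hble := pos_le_of_lt_next (k := b) (l := b') hb (by omega)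
  have hback := isCross_start h h0 ha ha1 ha2 hb hb1 hb2
  obtain ⟨D, r₁, hD, hr₁⟩ : ∃ (D : Path b' b) (r' : Path b a'), AllArrows IsDown D ∧
      r = D.comp r' := by
    rcases hble.eq_or_lt with heq | hlt
    · obtain rfl := ext_pos hb heq
      exact ⟨Path.nil, r, trivial, (Path.nil_comp r).symm⟩
    · exact (exists_down h h0 hb hb2 hlt r hr).resolve_right fun h' => h.adj.ne h'.1
  obtain ⟨r₂, U, hU, hr₂⟩ : ∃ (r' : Path b a) (U : Path a a'), AllArrows IsUp U ∧
      r₁ = r'.comp U := by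
    rcases hale.eq_or_lt with heq | hlt
    · obtain rfl := ext_pos ha heq
      exact ⟨r₁, Path.nil, trivial, rfl⟩
    · rw [hr₁, allArrows_comp] at hr
      exact (exists_up h h0 ha ha2 hlt r₁ hr.2 Path.nil trivial hlt).resolve_right
        fun h' => h.adj.ne (h'.symm.trans hb)
  refine ⟨⟨a, a', b, b', by rw [ha, hb]; exact h.adj, U, e, D,
    ⟨(isArrow_iff_isCross hback.adj).2 hback⟩, hU, hD, no_arrow_inside h ha ha2 hb hb2⟩,
    r₂, rfl, rfl, ?_⟩
  rw [hr₁, hr₂]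
  exact (Path.comp_assoc _ _ _).symm

/-- If the graph is a forest, no cycle crosses from one string to another one only at the bottom. -/
theorem no_bottom_cycle (hΓ : Γ.IsAcyclic) {x y : Vertex Γ w} (h : IsCross x y)
    (h0 : max x.pos y.pos = 0) (r : Path y x) (hr : AllArrows (fun k l => rank k l ≤ 1) r) :
    False := by
  have hbridge := SimpleGraph.isAcyclic_iff_forall_adj_isBridge.1 hΓ h.adj
  rw [SimpleGraph.isBridge_iff] at hbridge
  -- The path stays at the bottom, avoiding the bridge, or it has climbed a string; from a vertex of
  -- sign 1 it can then neither descend nor use a bottom arrow.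
  have key : ∀ {z : Vertex Γ w} (r : Path y z), AllArrows (fun k l => rank k l ≤ 1) r →
      (z.pos = 0 ∧ (Γ.deleteEdges {s(x.str, y.str)}).Reachable y.str z.str) ∨
        (0 < z.pos ∧ z.sgn = 1) := by
    intro z r hr
    induction r with
    | nil => exact .inl ⟨by omega, SimpleGraph.Reachable.refl _⟩
    | cons r g ih =>
      rename_i z z'
      rcases g.down.isVert_or_isCross with (hg | hg) | hg
      · have := hg.lt
        exact .inr ⟨by omega, hg.2⟩
      · have := hg.lt
        rcases ih hr.1 with h1 | h1
        · omega
        · exact absurd hg.2 (not_sgn h1.2)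
      · have hmax : max z.pos z'.pos = 0 := by
          by_contra hne
          have h8 : rank z z' ≤ 1 := hr.2
          rw [rank_of_isCross hg (by omega)] at h8
          omega
        rcases ih hr.1 with h1 | h1
        · refine .inl ⟨by omega, h1.2.trans (SimpleGraph.Adj.reachable ?_)⟩
          rw [SimpleGraph.deleteEdges_adj]
          refine ⟨hg.adj, fun hmem => ?_⟩
          -- Reaching `x` first already contradicts the bridge property; the other direction would
          -- be an arrow opposite to `x → y`.
          rcases Sym2.eq_iff.1 (Set.mem_singleton_iff.1 hmem) with ⟨h2, h3⟩ | ⟨h2, h3⟩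
          · exact hbridge (h2 ▸ h1.2.symm)
          · obtain rfl : z = y := ext_pos h2 (by omega)
            obtain rfl : z' = x := ext_pos h3 (by omega)
            exact h.not_symm hg
        · omega
  rcases key r hr with h1 | h1
  · exact hbridge h1.2.symm
  · omega

theorem single_mem_trivialCycles [Finite I] (hΓ : Γ.IsAcyclic) (left : I → I → Prop)
    (c : ClosedPath (Vertex Γ w)) (hc : 0 < c.2.length) :
    Finsupp.single c 1 ∈ trivialCycles (superpotential Γ w left) := by
  induction hn : arrowSum weight c.2 using Nat.strong_induction_on generalizing c with
  | _ n ih =>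
  subst hn
  obtain ⟨c₀, c⟩ := c
  obtain ⟨a', b', p₁, e, p₂, rfl, h1, h2⟩ := exists_max_arrow rank c hc
  have hr : AllArrows (fun k l => rank k l ≤ rank a' b') (p₂.comp p₁) :=
    (allArrows_comp _ _).2 ⟨h2, h1⟩
  rcases e.down.isVert_or_isCross with he | he
  -- If the maximal rank is 0, all arrows are vertical and the cycle would be strictly monotone.
  · exfalso
    have hv : AllArrows IsVert (e.toPath.comp (p₂.comp p₁)) := by
      refine (allArrows_comp _ _).2 ⟨⟨trivial, he⟩, hr.mono fun k l g hkl => ?_⟩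
      refine g.down.isVert_or_isCross.resolve_right fun hg => ?_
      have := rank_pos hg
      rw [show rank a' b' = 0 from if_pos he.str_eq] at hkl
      omega
    rcases isUp_or_isDown_of_isVert hv with hv | hv
    · have h3 := (allArrows_comp _ _).1 hv
      have := up_pos_le _ h3.2
      have := h3.1.2.lt
      omega
    · have h3 := (allArrows_comp _ _).1 hv
      have := down_pos_le _ h3.2
      have := h3.1.2.lt
      omega
  · rcases Nat.eq_zero_or_pos (max a'.pos b'.pos) with h0 | h0
    · rw [rank_of_bottom he h0] at hr
      exact (no_bottom_cycle hΓ he h0 _ hr).elim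
    · obtain ⟨f, r', rfl, rfl, hf⟩ := exists_face e he h0 _ hr
      replace hf : p₂.comp p₁ = (f.down.comp r').comp f.up := hf
      have hsum : arrowSum weight ((p₁.cons e).comp p₂) =
          weight f.a' f.b' + arrowSum weight r' := by
        have h3 := congrArg (arrowSum weight) hf
        simp only [arrowSum_comp, arrowSum,
          arrowSum_weight_of_isVert (allArrows_isVert_of_isUp f.isUp),
          arrowSum_weight_of_isVert (allArrows_isVert_of_isDown f.isDown)] at h3 ⊢
        omega
      -- Two rotations bring the cycle to the form `r' · up · across · down`.
      refine single_mem_trivialCycles_rotate (p₁.cons e) p₂ ?_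
      rw [Path.comp_cons, hf]
      have h4 := f.single_mem_trivialCycles left r' fun c hc hlt =>
        ih _ (hlt.trans_eq hsum.symm) c hc rfl
      rw [Subsingleton.elim e f.across]
      rw [← Path.comp_cons, Path.comp_assoc]
      refine single_mem_trivialCycles_rotate f.down (r'.comp (f.up.cons f.across)) ?_
      rw [Path.comp_assoc]
      exact h4

end BFZ

theorem theorem1p1 {I : Type*} [Finite I] (Γ : SimpleGraph I) (hΓ : Γ.IsAcyclic)
    (u v : BFZ.WeylGroup Γ) (w : List (I × ℤˣ)) (hw : BFZ.IsReducedWordFor Γ u v w)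
    (left : I → I → Prop) (hleft : BFZ.IsDrawing Γ left) :
    QP.IsRigid (BFZ.superpotential Γ w left) :=
  QP.isRigid_of_mem_trivialCycles (BFZ.single_mem_trivialCycles hΓ left)
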